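/- **Setting.** Let $\mathcal M(\mathbf Z)$ be the Berkovich spectrum of $(\mathbf Z,|\cdot|_\infty)$, i.e. the set of multiplicative seminorms on $\mathbf Z$ with the topology of pointwise convergence. Let $a_0$ be the point given by the trivial absolute value, and, for a place $v\in M_{\mathbf Q}$, let $a_v$ be the point given by the usual normalised absolute value of $v$ (the usual one for $v=\infty$; $|p|_p=1/p$ for $v=p$). For $M\in\mathbf Z$ put $\mathcal U_M=\{x\in\mathcal M(\mathbf Z): |M|_x\neq 0\}$. Let $N\in\mathbf Z\setminus\{0\}$, let $\mathcal Y$ be a scheme locally of finite type over $\mathbf Z[\frac1N]$ with non-empty generic fibre, let $Y=\mathcal Y^{\mathrm{an}}$ be its Berkovich analytification (its points $x$ are the points of $\mathcal Y$ equipped with an absolute value $|\cdot|_x$ on the residue field, and its topology is the coarsest one for which, for every open $W\subseteq\mathcal Y$ and every $g\in\mathcal O(W)$, the set $W^{\mathrm{an}}$ of points above $W$ is open and $x\mapsto|g(x)|$ is continuous on it), and let $\mathrm{pr}\colon Y\to\mathcal M(\mathbf Z)$ be the structure map. For $x\in Y$ and $\varepsilon>0$, let $x^\varepsilon$ be the point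 given by $|\cdot|_x^\varepsilon$, whenever this is an absolute value; this is the case for all $\varepsilon\in(0,1]$, and for all $\varepsilon>0$ if $|\cdot|_x$ is non-archimedean. A subset $V\subseteq Y$ is called *floating* if for every $x\in V$ one has $x^\varepsilon\in V$ for all $\varepsilon\in(0,1]$ and, if $|\cdot|_x$ is non-archimedean, for all $\varepsilon>0$. A function $f\colon V\to\mathbf R$ on a floating set is called *log-floating* if $f(y^\varepsilon)=\varepsilon f(y)$ for all $y\in V$ and $\varepsilon\in(0,1]$. **Statement.** Let $V\subseteq Y$ be a floating subset such that $\mathrm{pr}(V)=\mathcal U_{N_V}$ for some $N_V\in\mathbf Z$, and let $\mathcal E,f_1,f_2\colon V\to\mathbf R$ be continuous log-floating functions. Suppose that there are $s_0\in\mathbf R_{>0}$ such that the map $\mathrm{pr}\colon\{y\in V: f_1(y)=s_0\}\to\mathcal U_{N_V}$ is closed, and $e_0\in\mathbf R$ such that $$\mathcal E(y)\ge e_0+f_2(y)\quad\text{for all } y\in V \text{ with } f_1(y)=s_0 \text{ and } \mathrm{pr}(y)=a_0 .$$ Then for every $\alpha\in\mathbf R_{>0}$ there exist $t_\alpha\in\mathbf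 R_{>0}$ and a finite set $M_\alpha\subset M_{\mathbf Q}$ of places such that $$\forall v\in M_{\mathbf Q}\setminus M_\alpha,\ \forall y\in V\text{ with } f_1(y)>0,\ \mathrm{pr}(y)=a_v:\quad \mathcal E(y)\ge\frac{e_0-\alpha}{s_0}f_1(y)+f_2(y),$$ and $$\forall v\in M_\alpha,\ \forall y\in V\text{ with } f_1(y)>t_\alpha,\ \mathrm{pr}(y)=a_v:\quad \mathcal E(y)\ge\frac{e_0-\alpha}{s_0}f_1(y)+f_2(y).$$ -/

import Mathlib

open CategoryTheory AlgebraicGeometry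

universe u

noncomputable section

namespace ZBerk

/-! ### The analytic spectrum of `ℤ` -/

/-- The analytic spectrum `M(ℤ)` of `(ℤ, |·|_∞)`: the set of multiplicative seminorms on `ℤ`.
The boundedness condition `|n| ≤ |n|_∞` follows from the triangle inequality and `|±1| = 1`. -/
def SpectrumZ : Type := MulRingSeminorm ℤ

namespace SpectrumZ

/-- The value `|n|_x`. -/
def eval (x : SpectrumZ) (n : ℤ) : ℝ := (show MulRingSeminorm ℤ from x) n

/-- The topology of pointwise convergence: the coarsest one for which all the maps
`x ↦ |n|_x` are continuous. -/
instance : TopologicalSpace SpectrumZ :=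
  TopologicalSpace.induced eval inferInstance

/-- The point `a₀`, that is, the trivial absolute value on `ℤ`. -/
def trivialPoint : SpectrumZ := (1 : MulRingSeminorm ℤ)

/-- The restriction to `ℤ` of an absolute value on a field. -/
def ofAbsoluteValue {K : Type*} [Field K] (v : AbsoluteValue K ℝ) : SpectrumZ where
  toFun n := v (n : K)
  map_zero' := by simp
  add_le' a b := by rw [Int.cast_add]; exact v.add_le _ _
  neg' a := by simp
  map_one' := by simp
  map_mul' a b := by simp

/-- `U_N = {x ∈ M(ℤ) : |N|_x ≠ 0}`. -/
def U (N : ℤ) : Set SpectrumZ := {x | x.eval N ≠ 0}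

end SpectrumZ

/-- The set `M_ℚ` of places of `ℚ`: the infinite place and one place for each prime number. -/
inductive Place : Type where
  | infinite : Place
  | prime (p : Nat.Primes) : Place

/-- The point `a_v` of `M(ℤ)` given by the normalised absolute value of the place `v`: the usual
absolute value for the infinite place, and the `p`-adic absolute value with `|p|_p = 1 / p` for
the place of the prime number `p`. -/
def Place.point : Place → SpectrumZ
  | .infinite => SpectrumZ.ofAbsoluteValue Rat.AbsoluteValue.real
  | .prime p =>
      haveI : Fact (p : ℕ).Prime := ⟨p.2⟩
      SpectrumZ.ofAbsoluteValue (Rat.AbsoluteValue.padic (p : ℕ))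

/-! ### Analytification -/

/-- A point of the Berkovich analytification `X^an` over `(ℤ, |·|_∞)` of a scheme `X`: a point of
`X` together with a (real) absolute value on its residue field. When `X = Spec A` is affine, this
is the same thing as a multiplicative seminorm on the ring `A`. As for `SpectrumZ`, the condition
that the induced seminorm on `ℤ` be bounded by `|·|_∞` is automatic.

If `X` is a scheme over `ℤ[1/N]`, the integer `N` is invertible in all the residue fields, so the
points lie above `U_N` (see `An.pr_mem_U`), and this is also the union over `α > 0` of
the analytifications of `X` over `(ℤ[1/N], max(|·|_∞, |·|_p ^ α, p ∣ N))`, restricted to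
the interiors of the spectra of these Banach rings. -/
@[ext]
structure An (X : Scheme.{u}) : Type u where
  /-- The image in the scheme `X`. -/
  pt : X
  /-- The absolute value on the residue field. -/
  abv : AbsoluteValue (X.residueField pt) ℝ

namespace An

variable {X : Scheme.{u}}

/-- The Berkovich topology: the coarsest one for which, for all open subschemes `W` of `X` and
all `g ∈ Γ(X, W)`, the set of points lying above `W` is open and
the function `x ↦ |g(x)|` is continuous on it. -/
instance : TopologicalSpace (An X) :=
  TopologicalSpace.generateFrom
    {S | ∃ (W : X.Opens) (g : Γ(X, W)) (O : Set ℝ), IsOpen O ∧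
      S = {x : An X | ∃ hx : x.pt ∈ W, x.abv (X.evaluation W x.pt hx g) ∈ O}}

/-- The structural map `pr : X^an → M(ℤ)`. -/
def pr (x : An X) : SpectrumZ := SpectrumZ.ofAbsoluteValue x.abv

/-- `x.PowDefined ε`: the real number `ε` is positive and the `ε`-th power of `|·|_x` is again an
absolute value (only the triangle inequality can fail), so that `x^ε` is
a point of `X^an`. -/
def PowDefined (x : An X) (ε : ℝ) : Prop :=
  0 < ε ∧ ∀ a b : X.residueField x.pt, x.abv (a + b) ^ ε ≤ x.abv a ^ ε + x.abv b ^ ε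

/-- The flow: the point `x^ε` given by the `ε`-th power of the absolute value `|·|_x`. -/
def pow (x : An X) (ε : ℝ) (h : x.PowDefined ε) : An X where
  pt := x.pt
  abv :=
    { toFun := fun a => x.abv a ^ ε
      map_mul' := fun a b => by
        rw [map_mul, Real.mul_rpow (x.abv.nonneg a) (x.abv.nonneg b)]
      nonneg' := fun a => Real.rpow_nonneg (x.abv.nonneg a) ε
      eq_zero' := fun a => by
        rw [Real.rpow_eq_zero (x.abv.nonneg a) h.1.ne', x.abv.eq_zero]
      add_le' := h.2 }

/-- `x^ε` is defined for all `x` and all `ε ∈ (0, 1]`. -/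
theorem powDefined_of_le_one (x : An X) {ε : ℝ} (h0 : 0 < ε) (h1 : ε ≤ 1) : x.PowDefined ε :=
  ⟨h0, fun a b =>
    (Real.rpow_le_rpow (x.abv.nonneg _) (x.abv.add_le a b) h0.le).trans
      (Real.rpow_add_le_add_rpow (x.abv.nonneg a) (x.abv.nonneg b) h0.le h1)⟩

/-- If `|·|_x` is non-archimedean, then `x^ε` is defined for all `ε > 0`. -/
theorem powDefined_of_isNonarchimedean (x : An X) (hx : IsNonarchimedean x.abv) {ε : ℝ}
    (h0 : 0 < ε) : x.PowDefined ε := by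
  refine ⟨h0, fun a b => ?_⟩
  have ha := Real.rpow_nonneg (x.abv.nonneg a) ε
  have hb := Real.rpow_nonneg (x.abv.nonneg b) ε
  have h := Real.rpow_le_rpow (x.abv.nonneg _) (hx a b) h0.le
  rcases max_choice (x.abv a) (x.abv b) with hm | hm <;> rw [hm] at h <;> linarith

/-- The points of the analytification of a scheme over `ℤ[1/N]` lie above `U_N`. -/
theorem pr_mem_U {N : ℤ} (π : X ⟶ Spec (.of (ULift.{u} (Localization.Away N)))) (x : An X) :
    x.pr ∈ SpectrumZ.U N := by
  let φ : ULift.{u} (Localization.Away N) →+* X.residueField x.pt :=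
    (X.Γevaluation x.pt).hom.comp ((Scheme.ΓSpecIso _).inv ≫ π.appTop).hom
  have hu : IsUnit (algebraMap ℤ (Localization.Away N) N) :=
    IsLocalization.Away.algebraMap_isUnit N
  have hv := (hu.map (ULift.ringEquiv (R := Localization.Away N)).symm.toRingHom).map φ
  have hN : (N : X.residueField x.pt) ≠ 0 := by
    have := hv.ne_zero
    simpa using this
  exact (x.abv.ne_zero_iff).2 hN

/-- A subset `V` of `X^an` is floating if it is stable under the flow: it contains `x^ε` for all
`x ∈ V` and all `ε ∈ (0, 1]`, and even for all `ε > 0` at the points `x ∈ V` such that `|·|_x` is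
non-archimedean. By the two theorems above, `x^ε` is a point of `X^an`
in all these cases. -/
def IsFloating (V : Set (An X)) : Prop :=
  ∀ x ∈ V, ∀ (ε : ℝ) (h : x.PowDefined ε), ε ≤ 1 ∨ IsNonarchimedean x.abv → x.pow ε h ∈ V

/-- A function `f : V → ℝ` is log-floating if `f(y^ε) = ε f(y)` for all `ε ∈ (0, 1]`. -/
def IsLogFloating {V : Set (An X)} (f : V → ℝ) : Prop :=
  ∀ (y z : V) (ε : ℝ) (h : (y : An X).PowDefined ε), ε ≤ 1 →
    (z : An X) = (y : An X).pow ε h → f z = ε * f y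

end An

end ZBerk

end

open Filter Topology

namespace ZBerk

namespace SpectrumZ

/-! The locus in `{f₁ = s₀}` where `E - f₂ ≤ e₀ - α` is closed, so its image in `U_{N_V}` is closed,
and it misses `a₀` by the central hypothesis. The inequality thus holds on `{f₁ = s₀}` over a
neighbourhood of `a₀`, which contains all but finitely many branches of `M(ℤ)` and the start of each
of the others (`exists_branches_of_mem_nhds`). A point `y` over `a_v` with `f₁ y > 0` is moved by
the flow to `y^ε` with `ε = s₀ / f₁ y`, where `f₁ = s₀`. Both sides scale by `ε`, so the inequality
at `y^ε` returns to `y`. -/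

theorem eval_trivialPoint (n : ℤ) : trivialPoint.eval n = if n = 0 then 0 else 1 :=
  MulRingSeminorm.apply_one n

theorem eval_ofAbsoluteValue {K : Type*} [Field K] (v : AbsoluteValue K ℝ) (n : ℤ) :
    (ofAbsoluteValue v).eval n = v (n : K) :=
  rfl

theorem trivialPoint_mem_U {N : ℤ} (hN : N ≠ 0) : trivialPoint ∈ U N := by
  simp [U, eval_trivialPoint, hN]

theorem U_zero : U 0 = ∅ :=
  Set.eq_empty_of_forall_notMem fun x hx => hx (map_zero (show MulRingSeminorm ℤ from x))

end SpectrumZ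

namespace Place

theorem eval_point_zero (v : Place) : v.point.eval 0 = 0 :=
  map_zero (show MulRingSeminorm ℤ from v.point)

theorem eval_point_prime (p : Nat.Primes) (n : ℤ) :
    (prime p).point.eval n = padicNorm p n := by
  have : Fact (p : ℕ).Prime := ⟨p.2⟩
  exact Rat.AbsoluteValue.padic_eq_padicNorm (p : ℕ) (n : ℚ)

theorem eval_point_prime_le_one (p : Nat.Primes) (n : ℤ) : (prime p).point.eval n ≤ 1 := by
  have : Fact (p : ℕ).Prime := ⟨p.2⟩
  rw [eval_point_prime]
  exact_mod_cast padicNorm.of_int n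

theorem eval_point_prime_eq_one {p : Nat.Primes} {n : ℤ} (h : ¬ ((p : ℕ) : ℤ) ∣ n) :
    (prime p).point.eval n = 1 := by
  have : Fact (p : ℕ).Prime := ⟨p.2⟩
  rw [eval_point_prime]
  exact_mod_cast (padicNorm.int_eq_one_iff n).2 h

theorem eval_point_ne_zero (v : Place) {n : ℤ} (hn : n ≠ 0) : v.point.eval n ≠ 0 := by
  cases v with
  | infinite => exact (Rat.AbsoluteValue.real.ne_zero_iff).2 (Int.cast_ne_zero.2 hn)
  | prime p =>
    have : Fact (p : ℕ).Prime := ⟨p.2⟩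
    exact ((Rat.AbsoluteValue.padic (p : ℕ)).ne_zero_iff).2 (Int.cast_ne_zero.2 hn)

/-- On each branch of `M(ℤ)`, the points `a_v ^ ε` tend to `a₀` as `ε` tends to `0`. -/
theorem tendsto_eval_point_rpow (v : Place) (n : ℤ) :
    Tendsto (fun ε : ℝ => v.point.eval n ^ ε) (𝓝[>] 0) (𝓝 (SpectrumZ.trivialPoint.eval n)) := by
  rw [SpectrumZ.eval_trivialPoint]
  by_cases hn : n = 0
  · subst hn
    refine tendsto_const_nhds.congr' ?_
    filter_upwards [self_mem_nhdsWithin] with ε hε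
    rw [eval_point_zero, Real.zero_rpow (ne_of_gt hε), if_pos rfl]
  · rw [if_neg hn, ← Real.rpow_zero (v.point.eval n)]
    exact (Real.continuousAt_const_rpow (v.eval_point_ne_zero hn)).tendsto.mono_left
      nhdsWithin_le_nhds

end Place

theorem finite_setOf_primes_dvd {I : Set ℤ} (hI : I.Finite) :
    {p : Nat.Primes | ∃ n ∈ I, n ≠ 0 ∧ ((p : ℕ) : ℤ) ∣ n}.Finite := by
  refine Set.Finite.subset (Set.Finite.preimage (f := fun p : Nat.Primes => (p : ℕ))
    Subtype.val_injective.injOn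
    (hI.biUnion fun n _ => (n.natAbs.primeFactors : Finset ℕ).finite_toSet)) ?_
  rintro p ⟨n, hnI, hn, hp⟩
  refine Set.mem_biUnion hnI ?_
  rw [Finset.mem_coe, Nat.mem_primeFactors]
  exact ⟨p.2, Int.natCast_dvd.1 hp, Int.natAbs_ne_zero.2 hn⟩

/-- A neighbourhood of `a₀` contains all but finitely many branches of `M(ℤ)`, and
an initial segment of each of the others. -/
theorem SpectrumZ.exists_branches_of_mem_nhds {W : Set SpectrumZ}
    (hW : W ∈ 𝓝 SpectrumZ.trivialPoint) :
    ∃ M : Set Place, M.Finite ∧ Place.infinite ∈ M ∧ ∃ η : ℝ, 0 < η ∧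
      ∀ (v : Place) (ε : ℝ), 0 < ε → (v ∉ M ∨ ε < η) →
        ∀ x : SpectrumZ, (∀ n, x.eval n = v.point.eval n ^ ε) → x ∈ W := by
  rw [nhds_induced, mem_comap] at hW
  obtain ⟨T, hT, hTW⟩ := hW
  have hT' := hT
  rw [nhds_pi, Filter.mem_pi] at hT'
  obtain ⟨I, hI, t, ht, htT⟩ := hT'
  -- A basic neighbourhood tests only the finitely many `n ∈ I`. At a prime dividing no nonzero one
  -- of them, every `|n|^ε` with `n ∈ I` is already trivial, for all `ε`.
  set M : Set Place := insert Place.infinite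
    (Place.prime '' {p : Nat.Primes | ∃ n ∈ I, n ≠ 0 ∧ ((p : ℕ) : ℤ) ∣ n}) with hM
  have hMf : M.Finite := ((finite_setOf_primes_dvd hI).image _).insert _
  have hev : ∀ᶠ ε : ℝ in 𝓝[>] 0, ∀ v ∈ M, (fun n => v.point.eval n ^ ε) ∈ T :=
    (eventually_all_finite hMf).2 fun v _ =>
      (tendsto_pi_nhds.2 v.tendsto_eval_point_rpow).eventually hT
  obtain ⟨η, hη, hηT⟩ := mem_nhdsGT_iff_exists_Ioo_subset.1 hev
  refine ⟨M, hMf, Set.mem_insert _ _, η, hη, fun v ε hε h x hx => hTW ?_⟩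
  have hx' : x.eval = fun n => v.point.eval n ^ ε := funext hx
  rw [Set.mem_preimage, hx']
  by_cases hv : v ∈ M
  · exact hηT ⟨hε, h.resolve_left (not_not.2 hv)⟩ v hv
  · refine htT fun n hn => ?_
    suffices v.point.eval n ^ ε = SpectrumZ.trivialPoint.eval n by
      simp only [this]
      exact mem_of_mem_nhds (ht n)
    rw [SpectrumZ.eval_trivialPoint]
    split_ifs with h0
    · rw [h0, Place.eval_point_zero, Real.zero_rpow hε.ne']
    · cases v with
      | infinite => exact absurd (Set.mem_insert _ _) hv
      | prime p =>
        rw [Place.eval_point_prime_eq_one, Real.one_rpow]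
        exact fun hp => hv (Set.mem_insert_of_mem _ ⟨p, ⟨n, hn, h0, hp⟩, rfl⟩)

theorem isNonarchimedean_of_natCast_le_one {K : Type*} [Field K] (v : AbsoluteValue K ℝ)
    (h : ∀ n : ℕ, v n ≤ 1) : IsNonarchimedean v := by
  let := v.toNormedField
  have : IsUltrametricDist K :=
    IsUltrametricDist.isUltrametricDist_of_forall_norm_natCast_le_one h
  exact fun x y => IsUltrametricDist.norm_add_le_max x y

namespace An

variable {X : Scheme.{u}}

theorem eval_pr_pow (x : An X) (ε : ℝ) (h : x.PowDefined ε) (n : ℤ) :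
    (x.pow ε h).pr.eval n = x.pr.eval n ^ ε :=
  rfl

/-- Being non-archimedean is detected on the integers. Over a finite place this makes the flow
available for `ε > 1` too. -/
theorem isNonarchimedean_of_pr_eq_prime {x : An X} {p : Nat.Primes}
    (hx : x.pr = (Place.prime p).point) : IsNonarchimedean x.abv := by
  refine isNonarchimedean_of_natCast_le_one _ fun n => ?_
  have h : x.pr.eval n ≤ 1 := hx ▸ Place.eval_point_prime_le_one p n
  simpa [pr, SpectrumZ.eval_ofAbsoluteValue] using h

theorem powDefined_inv_pow (x : An X) {ε : ℝ} (h : x.PowDefined ε) :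
    (x.pow ε h).PowDefined ε⁻¹ := by
  have hinv (c : X.residueField x.pt) : (x.abv c ^ ε) ^ ε⁻¹ = x.abv c :=
    Real.rpow_rpow_inv (x.abv.nonneg c) h.1.ne'
  have hadd (a b : X.residueField x.pt) :
      (x.abv (a + b) ^ ε) ^ ε⁻¹ ≤ (x.abv a ^ ε) ^ ε⁻¹ + (x.abv b ^ ε) ^ ε⁻¹ := by
    rw [hinv, hinv, hinv]
    exact x.abv.add_le a b
  exact ⟨inv_pos.2 h.1, hadd⟩

theorem pow_pow_inv (x : An X) {ε : ℝ} (h : x.PowDefined ε) :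
    (x.pow ε h).pow ε⁻¹ (x.powDefined_inv_pow h) = x := by
  refine An.ext rfl (heq_of_eq (AbsoluteValue.ext fun a => ?_))
  exact Real.rpow_rpow_inv (x.abv.nonneg a) h.1.ne'

/-- A log-floating function satisfies `f(y^ε) = ε f(y)` also when `ε > 1`. -/
theorem IsLogFloating.apply_pow {V : Set (An X)} {f : V → ℝ} (hf : IsLogFloating f)
    (y : V) (ε : ℝ) (h : (y : An X).PowDefined ε) (hmem : (y : An X).pow ε h ∈ V) :
    f ⟨(y : An X).pow ε h, hmem⟩ = ε * f y := by
  rcases le_total ε 1 with h1 | h1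
  · exact hf y _ ε h h1 rfl
  -- The log-floating property is used at `y^ε` with exponent `ε⁻¹ ≤ 1`, which leads back to `y`.
  · rw [hf ⟨(y : An X).pow ε h, hmem⟩ y ε⁻¹ (powDefined_inv_pow _ h) (inv_le_one_of_one_le₀ h1)
      (pow_pow_inv _ h).symm, mul_inv_cancel_left₀ h.1.ne']

theorem powDefined_of_le_one_or (x : An X) {ε : ℝ} (h0 : 0 < ε)
    (h : ε ≤ 1 ∨ IsNonarchimedean x.abv) : x.PowDefined ε :=
  h.elim (x.powDefined_of_le_one h0) fun h => x.powDefined_of_isNonarchimedean h h0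

end An

end ZBerk

theorem mainTheorem9
    -- the scheme, locally of finite type over `ℤ[1/N]`, with a non-empty generic fibre
    (N : ℤ) (hN : N ≠ 0) (𝒴 : Scheme.{u})
    (π : 𝒴 ⟶ Spec (.of (ULift.{u} (Localization.Away N)))) [LocallyOfFiniteType π]
    (hgen : ∃ y : 𝒴, CharZero (𝒴.residueField y))
    -- the floating part `V` of the analytification, with image `U_{N_V}`
    (V : Set (ZBerk.An 𝒴)) (hV : ZBerk.An.IsFloating V)
    (NV : ℤ) (hpr : ZBerk.An.pr '' V = ZBerk.SpectrumZ.U NV)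
    -- the continuous log-floating functions
    (E f₁ f₂ : C(V, ℝ)) (hE : ZBerk.An.IsLogFloating E)
    (hf₁ : ZBerk.An.IsLogFloating f₁) (hf₂ : ZBerk.An.IsLogFloating f₂)
    (s₀ : ℝ) (hs₀ : 0 < s₀)
    -- the map `pr : {f₁ = s₀} → U_{N_V}` is closed
    (hclosed : IsClosedMap
      (fun y : {y : V // f₁ y = s₀} =>
        (⟨ZBerk.An.pr (y.1 : ZBerk.An 𝒴), hpr ▸ Set.mem_image_of_mem ZBerk.An.pr y.1.2⟩ :
          ZBerk.SpectrumZ.U NV)))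
    (e₀ : ℝ)
    (hcentral : ∀ y : V, f₁ y = s₀ →
      ZBerk.An.pr (y : ZBerk.An 𝒴) = ZBerk.SpectrumZ.trivialPoint → e₀ + f₂ y ≤ E y)
    (α : ℝ) (hα : 0 < α) :
    ∃ t : ℝ, 0 < t ∧ ∃ M : Set ZBerk.Place, M.Finite ∧
      (∀ v, v ∉ M → ∀ y : V, 0 < f₁ y → ZBerk.An.pr (y : ZBerk.An 𝒴) = v.point →
        (e₀ - α) / s₀ * f₁ y + f₂ y ≤ E y) ∧
      (∀ v, v ∈ M → ∀ y : V, t < f₁ y → ZBerk.An.pr (y : ZBerk.An 𝒴) = v.point →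
        (e₀ - α) / s₀ * f₁ y + f₂ y ≤ E y) := by
  -- If `N_V = 0`, then `a₀ ∉ U_{N_V}`, but `V` is empty.
  rcases eq_or_ne NV 0 with rfl | hNV
  · rw [ZBerk.SpectrumZ.U_zero, Set.image_eq_empty] at hpr
    subst hpr
    exact ⟨1, one_pos, ∅, Set.finite_empty, fun _ _ y => y.2.elim, fun _ _ y => y.2.elim⟩
  -- the image of the locus where the inequality fails on `{f₁ = s₀}` is closed and avoids `a₀`
  obtain ⟨W, hW, hWy⟩ : ∃ W ∈ 𝓝 ZBerk.SpectrumZ.trivialPoint,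
      ∀ y : V, f₁ y = s₀ → ZBerk.An.pr (y : ZBerk.An 𝒴) ∈ W → e₀ - α < E y - f₂ y := by
    have hZ : IsClosed {y : {y : V // f₁ y = s₀} | E y.1 - f₂ y.1 ≤ e₀ - α} :=
      isClosed_le (by fun_prop) continuous_const
    obtain ⟨W, hWo, hWZ⟩ := isOpen_induced_iff.1 (hclosed _ hZ).isOpen_compl
    refine ⟨W, hWo.mem_nhds ?_, fun y hy hyW => ?_⟩
    · change (⟨_, ZBerk.SpectrumZ.trivialPoint_mem_U hNV⟩ : ZBerk.SpectrumZ.U NV) ∈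
        Subtype.val ⁻¹' W
      rw [hWZ]
      rintro ⟨y, hyZ, hy⟩
      have h1 := hcentral y.1 y.2 (congrArg Subtype.val hy)
      have h2 : E y.1 - f₂ y.1 ≤ e₀ - α := hyZ
      linarith
    · by_contra hlt
      have hmem : (⟨ZBerk.An.pr (y : ZBerk.An 𝒴),
          hpr ▸ Set.mem_image_of_mem ZBerk.An.pr y.2⟩ : ZBerk.SpectrumZ.U NV) ∈
            Subtype.val ⁻¹' W := hyW
      rw [hWZ] at hmem
      exact hmem ⟨⟨y, hy⟩, not_lt.1 hlt, rfl⟩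
  obtain ⟨M, hMf, hMinf, η, hη, hMη⟩ := ZBerk.SpectrumZ.exists_branches_of_mem_nhds hW
  -- With `ε = s₀ / f₁ y`, the first alternative puts `pr (y^ε)` in `W` and the second keeps `y^ε`
  -- in `V`.
  have key : ∀ v, ∀ y : V, 0 < f₁ y → ZBerk.An.pr (y : ZBerk.An 𝒴) = v.point →
      (v ∉ M ∨ s₀ / f₁ y < η) →
      (s₀ / f₁ y ≤ 1 ∨ IsNonarchimedean (y : ZBerk.An 𝒴).abv) →
        (e₀ - α) / s₀ * f₁ y + f₂ y ≤ E y := by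
    intro v y hy hv hM hε
    have hpos : 0 < s₀ / f₁ y := div_pos hs₀ hy
    have hp := ZBerk.An.powDefined_of_le_one_or _ hpos hε
    have hmem := hV y y.2 _ hp hε
    have hlt := hWy ⟨_, hmem⟩ (by rw [hf₁.apply_pow, div_mul_cancel₀ _ hy.ne'])
      (hMη v _ hpos hM _ fun n => by rw [ZBerk.An.eval_pr_pow, hv])
    rw [hE.apply_pow, hf₂.apply_pow, ← mul_sub, div_mul_eq_mul_div, lt_div_iff₀ hy] at hlt
    have : (e₀ - α) / s₀ * f₁ y ≤ E y - f₂ y := by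
      rw [div_mul_eq_mul_div, div_le_iff₀ hs₀]
      linarith
    linarith
  -- Beyond this threshold `ε < η` and `ε < 1`, so the flow is also defined at archimedean points.
  -- Outside `M` the place is finite, and any `ε > 0` is allowed.
  refine ⟨s₀ / min η 1, by positivity, M, hMf, fun v hvM y hy hv => ?_, fun v _ y hy hv => ?_⟩
  · refine key v y hy hv (Or.inl hvM) (Or.inr ?_)
    cases v with
    | infinite => exact absurd hMinf hvM
    | prime p => exact ZBerk.An.isNonarchimedean_of_pr_eq_prime hv
  · have hpos : 0 < f₁ y := lt_trans (by positivity) hy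
    rw [div_lt_comm₀ (by positivity) hpos, lt_min_iff] at hy
    exact key v y hpos hv (Or.inr hy.1) (Or.inl hy.2.le)
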